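/- \textbf{Conventions.} A Bratteli diagram $B$ has finite levels $V_0=\{v_0\},V_1,V_2,\dots$ and finite edge sets $E_n$ ($n\ge 1$) with source and range maps $s:E_n\to V_{n-1}$ and $r:E_n\to V_n$, both surjective. For $n\ge 0$ its incidence matrix $F_n$ has, for $v\in V_{n+1}$ and $w\in V_n$, the entry $(F_n)_{v,w}=|\{e\in E_{n+1}: r(e)=v,\ s(e)=w\}|$. An ordering $\omega$ is a linear order on each set $r^{-1}(v)$, $v\in V_n$, $n\ge1$; it orders the finite paths from level $m$ to a vertex $v$ of level $n>m$ lexicographically, comparing the last edges first. A path is maximal (minimal) if each of its edges $e$ is the largest (smallest) element of $r^{-1}(r(e))$. The space $X_B$ of infinite paths from $v_0$ has the topology generated by the cylinder sets. The ordering $\omega$ is perfect if there is a homeomorphism $\varphi$ of $X_B$ that maps the set of infinite maximal paths onto the set of infinite minimal paths and sends every non-maximal path $x=(x_1,x_2,\dots)$ to $(x_1^0,\dots,x_{j-1}^0,\overline{x_j},x_{j+1},\dots)$, where $j$ is the least index for which $x_j$ is not maximal in $r^{-1}(r(x_j))$, $\overline{x_j}$ is the successor of $x_j$ in $r^{-1}(r(x_j))$,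 and $(x_1^0,\dots,x_{j-1}^0)$ is the minimal path from $v_0$ to $s(\overline{x_j})$. Suppose that $V_n=V$ for all $n\ge 1$. For $v\in V_n$ and $1\le m<n$ let $w(v,m,n)$ be the word over $V$ formed by the sources of all paths from level $m$ to $v$, listed in increasing order. A path is vertical if it passes through the same vertex of $V$ at all levels $n\ge1$. A perfectly ordered diagram $(B,\omega)$ is well telescoped if 1. $|r^{-1}(v)|\ge 2$ for every $v\in V_n$, $n\ge1$; 2. all infinite maximal and minimal paths are vertical; let $\widetilde V$, respectively $\overline V$, be the set of the vertices through which the maximal, respectively minimal, ones run; 3. for every $v\in V_n$, $n\ge 2$, the source of the maximal edge of $r^{-1}(v)$ lies in $\widetilde V$, the source of the minimal edge lies in $\overline V$, and these two sources depend only on $v\in V$ and not on $n$; 4. there is a bijection $\sigma:\widetilde V\to\overline V$ such that whenever $\widetilde v\,\overline v$, with $\widetilde v\in\widetilde V$ and $\overline v\in\overline V$, is a subword of some $w(v,m,n)$ with $1\le m<n$, then $\overline v=\sigma(\widetilde v)$. The diagram $B$ belongs to the class $\mathcal A$ with $k$ minimal components if $V_n=V$ for all $n\ge1$ and, in a fixed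 enumeration of $V$, \[F_n=\begin{pmatrix}A_n^{(1)}&0&\cdots&0&0\\0&A_n^{(2)}&\cdots&0&0\\ \vdots&\vdots&\ddots&\vdots&\vdots\\0&0&\cdots&A_n^{(k)}&0\\B_n^{(1)}&B_n^{(2)}&\cdots&B_n^{(k)}&C_n\end{pmatrix}\qquad(n\ge1),\] where $A_n^{(i)}$ is a $d_i\times d_i$ matrix and $C_n$ a $d\times d$ matrix (with $d_i,d\ge1$ not depending on $n$), all the matrices $A_n^{(i)},B_n^{(i)},C_n$ have strictly positive entries, and for some fixed $j$ in the last block of indices the $j$-th row of every $F_n$, $n\ge1$, is strictly positive. The class $\mathcal M$ consists of the square matrices $F$ with entries in $\mathbb N=\{0,1,2,\dots\}$ for which there are numbers $f_i\in\mathbb N$ such that $F_{ii}=f_i+1$ for all $i$ and $F_{ij}=f_i$ for all $j\ne i$. \textbf{Proposition.} Let $B\in\mathcal A$ be a Bratteli diagram with $k$ minimal components for which every $C_n$, $n\ge 1$, is a $k\times k$ matrix. If $\omega$ is a perfect ordering on $B$ such that $(B,\omega)$ is well telescoped, then $C_n\in\mathcal M$ for all $n\ge 2$. -/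

import Mathlib

universe u

/-- A Bratteli diagram. `V n` is the set of vertices of level `n`, and `E n` is the set of edges
from level `n` to level `n + 1` (the set usually written `E_{n+1}`). -/
structure BratteliDiagram where
  V : ℕ → Type u
  E : ℕ → Type u
  finite_V : ∀ n, Finite (V n)
  finite_E : ∀ n, Finite (E n)
  /-- the source map -/
  s : ∀ {n : ℕ}, E n → V n
  /-- the range map -/
  r : ∀ {n : ℕ}, E n → V (n + 1)
  existsUnique_top : ∃! _v₀ : V 0, True
  s_surjective : ∀ n, Function.Surjective (s : E n → V n)
  r_surjective : ∀ n, Function.Surjective (r : E n → V (n + 1))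

namespace BratteliDiagram

variable (B : BratteliDiagram.{u})

/-- The set `r⁻¹(v)` of the edges with range `v`. -/
abbrev EdgesInto {n : ℕ} (v : B.V (n + 1)) : Type u := {e : B.E n // B.r e = v}

/-- The `n`-th incidence matrix: its entry at `(v, w)`, with `v` in level `n + 1` and `w` in
level `n`, is the number of edges from `w` to `v`. -/
noncomputable def incidence (n : ℕ) : Matrix (B.V (n + 1)) (B.V n) ℕ :=
  fun v w => Nat.card {e : B.E n // B.r e = v ∧ B.s e = w}

/-- The space of infinite paths that start at the top vertex; `x n` is the edge of the path `x`
between the levels `n` and `n + 1`. -/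
def PathSpace : Type u :=
  {x : ∀ n, B.E n // ∀ n, B.r (x n) = B.s (x (n + 1))}

/-- The topology generated by the cylinder sets `U(e_j, …, e_n)`. -/
instance : TopologicalSpace B.PathSpace :=
  TopologicalSpace.generateFrom
    {U | ∃ (j n : ℕ) (y : B.PathSpace),
      U = {x : B.PathSpace | ∀ i, j ≤ i → i ≤ n → x.1 i = y.1 i}}

/-- An ordering on a Bratteli diagram: a linear order on each set `r⁻¹(v)`, for `v` of
level at least one. -/
def Ordering : Type u := ∀ (n : ℕ) (v : B.V (n + 1)), LinearOrder (B.EdgesInto v)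

/-- The set of the finite paths from level `m` to the vertex `v` of level `m + l`, ordered first
by the last edge, then by the last edge but one, and so on. A path of length `l + 1` to `v` is an
edge `e` with range `v` together with a path of length `l` to the source of `e`. -/
def PathTo (m : ℕ) : (l : ℕ) → B.V (m + l) → Type u
  | 0, _ => PUnit
  | l + 1, v => Σₗ e : B.EdgesInto (n := m + l) v, PathTo m l (B.s e.1)

variable {B}

/-- The vertex of level `m` at which a finite path starts. -/
def PathTo.source {m : ℕ} : {l : ℕ} → {v : B.V (m + l)} → B.PathTo m l v → B.V m
  | 0, v, _ => v
  | _ + 1, _, p => PathTo.source (ofLex p).2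

theorem PathTo.finite (m : ℕ) : ∀ (l : ℕ) (v : B.V (m + l)), Finite (B.PathTo m l v)
  | 0, _ => inferInstanceAs (Finite PUnit)
  | l + 1, v => by
      have := B.finite_E (m + l)
      have : ∀ e : B.EdgesInto (n := m + l) v, Finite (B.PathTo m l (B.s e.1)) :=
        fun e => PathTo.finite m l (B.s e.1)
      exact inferInstanceAs
        (Finite (Σ e : B.EdgesInto (n := m + l) v, B.PathTo m l (B.s e.1)))

namespace Ordering

variable (ω : B.Ordering)

/-- The edge `e` is maximal among the edges with the same range. -/
def IsMaxEdge {n : ℕ} (e : B.E n) : Prop :=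
  ∀ f : B.EdgesInto (B.r e), (ω n (B.r e)).le f ⟨e, rfl⟩

/-- The edge `e` is minimal among the edges with the same range. -/
def IsMinEdge {n : ℕ} (e : B.E n) : Prop :=
  ∀ f : B.EdgesInto (B.r e), (ω n (B.r e)).le ⟨e, rfl⟩ f

/-- The edge `f` has the same range as `e` and is the immediate successor of `e`. -/
def IsSuccEdge {n : ℕ} (e f : B.E n) : Prop :=
  ∃ h : B.r f = B.r e, (ω n (B.r e)).lt ⟨e, rfl⟩ ⟨f, h⟩ ∧
    ∀ g : B.EdgesInto (B.r e), (ω n (B.r e)).lt ⟨e, rfl⟩ g → (ω n (B.r e)).le ⟨f, h⟩ g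

/-- The set of the maximal infinite paths. -/
def maxPaths : Set B.PathSpace := {x | ∀ n, ω.IsMaxEdge (x.1 n)}

/-- The set of the minimal infinite paths. -/
def minPaths : Set B.PathSpace := {x | ∀ n, ω.IsMinEdge (x.1 n)}

/-- `φ` is a (continuous) Vershik map: a homeomorphism that maps the set of maximal paths onto the
set of minimal paths and that replaces, in any other path `x`, the first edge that is not maximal
by its successor, and the initial segment above it by the minimal path. -/
def IsVershikMap (φ : B.PathSpace ≃ₜ B.PathSpace) : Prop :=
  φ '' ω.maxPaths = ω.minPaths ∧
  ∀ (x : B.PathSpace) (j : ℕ), (∀ i < j, ω.IsMaxEdge (x.1 i)) → ¬ ω.IsMaxEdge (x.1 j) →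
    (∀ i < j, ω.IsMinEdge ((φ x).1 i)) ∧
    ω.IsSuccEdge (x.1 j) ((φ x).1 j) ∧
    ∀ i, j < i → (φ x).1 i = x.1 i

/-- An ordering is perfect if it admits a Vershik map. -/
def IsPerfect : Prop := ∃ φ : B.PathSpace ≃ₜ B.PathSpace, ω.IsVershikMap φ

/-- The lexicographic order on the finite paths from level `m` to `v`. -/
@[reducible]
noncomputable def pathOrder (m : ℕ) :
    (l : ℕ) → (v : B.V (m + l)) → LinearOrder (B.PathTo m l v)
  | 0, _ => (inferInstance : LinearOrder PUnit)
  | l + 1, v =>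
      @Sigma.Lex.linearOrder (B.EdgesInto (n := m + l) v) (fun e => B.PathTo m l (B.s e.1))
        (ω (m + l) v) (fun e => pathOrder m l (B.s e.1))

/-- The word `w(v, m, m + l)`: the sources of all the paths from level `m` to the vertex `v` of
level `m + l`, listed in the increasing order of the paths. -/
noncomputable def word (m l : ℕ) (v : B.V (m + l)) : List (B.V m) :=
  letI := ω.pathOrder m l v
  letI : Fintype (B.PathTo m l v) := @Fintype.ofFinite _ (PathTo.finite m l v)
  ((Finset.univ : Finset (B.PathTo m l v)).sort (· ≤ ·)).map PathTo.source

end Ordering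

/-- An identification of every level `V n`, `n ≥ 1`, with one and the same set `W`
(`lab n` concerns the level `n + 1`). -/
abbrev Labelling (B : BratteliDiagram.{u}) (W : Type) : Type u := ∀ n : ℕ, B.V (n + 1) ≃ W

/-- The path `x` passes through the vertex `v` at each level `n ≥ 1`. -/
def PathSpace.IsVerticalThrough {W : Type} (lab : B.Labelling W) (x : B.PathSpace) (v : W) :
    Prop := ∀ n, lab n (B.r (x.1 n)) = v

namespace Ordering

variable {W : Type} (lab : B.Labelling W) (ω : B.Ordering)

/-- The set of the vertices through which vertical maximal paths run. -/
def maxVertices : Set W := {v | ∃ x ∈ ω.maxPaths, PathSpace.IsVerticalThrough lab x v}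

/-- The set of the vertices through which vertical minimal paths run. -/
def minVertices : Set W := {v | ∃ x ∈ ω.minPaths, PathSpace.IsVerticalThrough lab x v}

/-- The ordered diagram `(B, ω)`, all of whose levels `V n`, `n ≥ 1`, are identified with the
finite set `W`, is well telescoped. -/
structure IsWellTelescoped : Prop where
  two_le_card : ∀ (n : ℕ) (v : B.V (n + 1)), 2 ≤ Nat.card (B.EdgesInto v)
  maxPaths_vertical : ∀ x ∈ ω.maxPaths, ∃ v, PathSpace.IsVerticalThrough lab x v
  minPaths_vertical : ∀ x ∈ ω.minPaths, ∃ v, PathSpace.IsVerticalThrough lab x v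
  source_max_mem : ∀ (n : ℕ) (e : B.E (n + 1)), ω.IsMaxEdge e →
    lab n (B.s e) ∈ ω.maxVertices lab
  source_min_mem : ∀ (n : ℕ) (e : B.E (n + 1)), ω.IsMinEdge e →
    lab n (B.s e) ∈ ω.minVertices lab
  source_max_indep : ∀ (n n' : ℕ) (e : B.E (n + 1)) (e' : B.E (n' + 1)),
    ω.IsMaxEdge e → ω.IsMaxEdge e' → lab (n + 1) (B.r e) = lab (n' + 1) (B.r e') →
      lab n (B.s e) = lab n' (B.s e')
  source_min_indep : ∀ (n n' : ℕ) (e : B.E (n + 1)) (e' : B.E (n' + 1)),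
    ω.IsMinEdge e → ω.IsMinEdge e' → lab (n + 1) (B.r e) = lab (n' + 1) (B.r e') →
      lab n (B.s e) = lab n' (B.s e')
  /-- If `ω` is perfect, the two-letter words `a b`, with `a` a maximal and `b` a minimal vertex,
  that occur in the words `w(v, m, n)`, `1 ≤ m < n`, are governed by a bijection `σ`. -/
  exists_bijection : ω.IsPerfect → ∃ σ : ω.maxVertices lab ≃ ω.minVertices lab,
    ∀ (m l : ℕ) (v : B.V (m + 1 + (l + 1))) (a : ω.maxVertices lab) (b : ω.minVertices lab),
      [(a : W), (b : W)] <:+: (ω.word (m + 1) (l + 1) v).map (lab m) → σ a = b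

end Ordering

/-- The block matrix with diagonal blocks `A 1, …, A k, C`, with last block row
`L 1, …, L k, C`, and with zero blocks elsewhere. -/
def blockForm {k d : ℕ} {dims : Fin k → ℕ}
    (A : ∀ i, Matrix (Fin (dims i)) (Fin (dims i)) ℕ) (L : ∀ i, Matrix (Fin d) (Fin (dims i)) ℕ)
    (C : Matrix (Fin d) (Fin d) ℕ) :
    Matrix ((Σ i, Fin (dims i)) ⊕ Fin d) ((Σ i, Fin (dims i)) ⊕ Fin d) ℕ :=
  Matrix.fromBlocks (Matrix.blockDiagonal' A) 0 (Matrix.of fun j p => L p.1 j p.2) C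

/-- A presentation of `B` as a diagram of the class `𝒜` with `k` minimal components and with
`d × d` blocks `C n`: all levels `V n`, `n ≥ 1`, are identified with one index set, in such a way
that each incidence matrix `F n`, `n ≥ 1`, has the block form with strictly positive blocks
`A n i`, `L n i` and `C n`, and that some row of the last block row is strictly positive at all
levels. The blocks with `n = 0` play no role. -/
structure ClassA (B : BratteliDiagram.{u}) (k d : ℕ) where
  dims : Fin k → ℕ
  dims_pos : ∀ i, 0 < dims i
  lab : B.Labelling ((Σ i, Fin (dims i)) ⊕ Fin d)
  A : ℕ → ∀ i, Matrix (Fin (dims i)) (Fin (dims i)) ℕ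
  L : ℕ → ∀ i, Matrix (Fin d) (Fin (dims i)) ℕ
  C : ℕ → Matrix (Fin d) (Fin d) ℕ
  incidence_eq : ∀ n : ℕ,
    (B.incidence (n + 1)).reindex (lab (n + 1)) (lab n) =
      blockForm (A (n + 1)) (L (n + 1)) (C (n + 1))
  A_pos : ∀ n, 1 ≤ n → ∀ i a b, 0 < A n i a b
  L_pos : ∀ n, 1 ≤ n → ∀ i a b, 0 < L n i a b
  C_pos : ∀ n, 1 ≤ n → ∀ a b, 0 < C n a b
  exists_row_pos : ∃ j : Fin d, ∀ n, 1 ≤ n → ∀ v, 0 < blockForm (A n) (L n) (C n) (Sum.inr j) v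

end BratteliDiagram

/-- The class `ℳ` of matrices whose `i`-th row has the entry `f i + 1` on the diagonal and the
entry `f i` everywhere else. -/
def IsInClassM {d : ℕ} (F : Matrix (Fin d) (Fin d) ℕ) : Prop :=
  ∃ f : Fin d → ℕ, ∀ i j, F i j = if i = j then f i + 1 else f i

/-! Read every letter `a` of the alphabet as a directed edge from `S a`, the source of the minimal
edge into `a`, to `T a`, the `σ`-image of the source of the maximal edge into `a`. If `a b` are
consecutive sources of edges into `v`, the last path into `a` and the first path into `b` are
consecutive among the paths of length two to `v`, so condition 4 gives `T a = S b`. Hence the word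
of `v` is a walk from `S v` to `T v` (`exists_isWalk_edgeWord`).

Merge the vertices of this graph that lie in the same minimal component; those in the last block
become `none`. Letters of the `i`-th component become loops at `some i` (`component_tail`,
`component_head`) and can be deleted. What remains is a graph with only `k` edges, the letters of
the last block, and for each of them a walk through all `k` edges. The walks cannot get trapped in a
component, so each of the `k` components is the tail of an edge, and then of exactly one; the same
holds for heads. The walk of `v` therefore begins with `v`, and its remainder is a closed walk from
`T v` in which consecutive edges occur equally often. So all letters occur `f` times in the
remainder, and `v` occurs once more at the start: this is the row `v` of a matrix in `ℳ`
(`isInClassM_of_walks`). -/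

/-- The list `l` of edges of a directed multigraph, with tail map `S` and head map `T`, is a walk
from `x` to `y`. -/
def IsWalk {α X : Type*} (S T : α → X) : List α → X → X → Prop
  | [], x, y => x = y
  | a :: l, x, y => S a = x ∧ IsWalk S T l (T a) y

theorem List.countP_eq_pos_iff {α : Type*} [DecidableEq α] {l : List α} {a : α} :
    0 < l.countP (fun b => b = a) ↔ a ∈ l := by
  simp [List.countP_pos_iff]

/-! ### Walks in directed multigraphs -/

section Walk

variable {α β X : Type*} {S T : α → X}

theorem IsWalk.map {S T : β → X} (f : α → β) :
    ∀ {l : List α} {x y : X}, IsWalk (S ∘ f) (T ∘ f) l x y → IsWalk S T (l.map f) x y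
  | [], _, _, h => h
  | _ :: _, _, _, h => ⟨h.1, IsWalk.map f h.2⟩

theorem IsWalk.image {Y : Type*} (g : X → Y) :
    ∀ {l : List α} {x y : X}, IsWalk S T l x y →
      IsWalk (fun a => g (S a)) (fun a => g (T a)) l (g x) (g y)
  | [], _, _, h => congrArg g h
  | _ :: _, _, _, h => ⟨congrArg g h.1, IsWalk.image g h.2⟩

/-- Loops can be deleted from a walk. -/
theorem IsWalk.filterMap {S T : α → X} (f : α → Option β) {S' T' : β → X}
    (hnone : ∀ a, f a = none → S a = T a)
    (hsome : ∀ a b, f a = some b → S a = S' b ∧ T a = T' b) :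
    ∀ {l : List α} {x y : X}, IsWalk S T l x y → IsWalk S' T' (l.filterMap f) x y
  | [], _, _, h => h
  | a :: l, x, y, h => by
    have ih := IsWalk.filterMap f hnone hsome h.2
    cases hfa : f a with
    | none =>
      rw [List.filterMap_cons_none hfa, ← h.1, hnone a hfa]
      exact ih
    | some b =>
      rw [List.filterMap_cons_some hfa, ← h.1, (hsome a b hfa).1]
      rw [(hsome a b hfa).2] at ih
      exact ⟨rfl, ih⟩

/-- A walk cannot leave a vertex all of whose outgoing edges are loops. -/
theorem IsWalk.eq_of_trap {z : X} (hz : ∀ a, S a = z → T a = z) :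
    ∀ {l : List α} {y : X}, IsWalk S T l z y → y = z
  | [], _, h => h.symm
  | a :: l, y, h => IsWalk.eq_of_trap hz (l := l) (by rw [← hz a h.1]; simpa [hz a h.1] using h.2)

theorem IsWalk.eq_of_trap_of_mem {z : X} (hz : ∀ a, S a = z → T a = z) {a : α} (ha : S a = z) :
    ∀ {l : List α} {x y : X}, IsWalk S T l x y → a ∈ l → y = z
  | b :: l, x, y, h, hm => by
    rcases List.mem_cons.1 hm with rfl | hm
    · exact IsWalk.eq_of_trap hz (l := l) (by simpa [hz a ha] using h.2)
    · exact IsWalk.eq_of_trap_of_mem hz ha h.2 hm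

/-- Each edge of a walk other than the first one continues some edge. -/
theorem IsWalk.exists_pred {a : α} :
    ∀ {l : List α} {b : α} {y : X}, IsWalk S T l (T b) y → a ∈ l → ∃ c, T c = S a
  | c :: l, b, y, h, hm => by
    rcases List.mem_cons.1 hm with rfl | hm
    · exact ⟨b, h.1.symm⟩
    · exact IsWalk.exists_pred h.2 hm

/-- Each edge of a walk other than the last one is continued by an edge of the walk. -/
theorem IsWalk.eq_or_exists_succ {a : α} :
    ∀ {l : List α} {x y : X}, IsWalk S T l x y → a ∈ l → T a = y ∨ ∃ c ∈ l, T a = S c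
  | b :: l, x, y, h, hm => by
    rcases List.mem_cons.1 hm with rfl | hm
    · cases l with
      | nil => exact Or.inl h.2
      | cons c l => exact Or.inr ⟨c, by simp, h.2.1.symm⟩
    · rcases IsWalk.eq_or_exists_succ h.2 hm with h | ⟨c, hc, h⟩
      · exact Or.inl h
      · exact Or.inr ⟨c, List.mem_cons_of_mem _ hc, h⟩

/-- Applied with `c` the number of occurrences of an edge in the walk itself. -/
theorem IsWalk.const_of_step {γ : Type*} {c : α → γ} (hc : ∀ a b, T a = S b → c a = c b) {a : α} :
    ∀ {l : List α} {b : α} {y : X}, IsWalk S T l (T b) y → a ∈ l → c a = c b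
  | d :: l, b, y, h, hm => by
    have hd : c b = c d := hc b d h.1.symm
    rcases List.mem_cons.1 hm with rfl | hm
    · exact hd.symm
    · exact (IsWalk.const_of_step hc h.2 hm).trans hd.symm

/-- A walk leaves each vertex as many times as it enters it, up to its two ends. -/
theorem IsWalk.countP_tail_add [DecidableEq X] (z : X) :
    ∀ {l : List α} {x y : X}, IsWalk S T l x y →
      l.countP (fun a => S a = z) + (if y = z then 1 else 0) =
        l.countP (fun a => T a = z) + (if x = z then 1 else 0)
  | [], x, y, h => by
    cases h
    simp
  | a :: l, x, y, h => by
    have ih := IsWalk.countP_tail_add z h.2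
    obtain rfl := h.1
    simp only [List.countP_cons, decide_eq_true_eq]
    omega

/-- A closed walk enters and leaves the vertex `S b` equally often; by injectivity `a` is the only
edge entering it and `b` the only edge leaving it. -/
theorem IsWalk.count_eq_of_closed [DecidableEq α] (hS : S.Injective) (hT : T.Injective)
    {l : List α} {x : X} (h : IsWalk S T l x x) {a b : α} (hab : T a = S b) :
    l.count a = l.count b := by
  classical
  have key := IsWalk.countP_tail_add (S b) h
  have h1 : l.countP (fun c => S c = S b) = l.count b := by
    rw [List.count]
    congr 1
    funext c
    rw [Bool.eq_iff_iff]; simp [hS.eq_iff]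
  have h2 : l.countP (fun c => T c = S b) = l.count a := by
    rw [List.count, ← hab]
    congr 1
    funext c
    rw [Bool.eq_iff_iff]; simp [hT.eq_iff]
  omega

/-! ### Increasing enumerations and covering pairs -/

/-- In a finite linear order whose covering pairs are composable, the increasing enumeration is
a walk. -/
theorem isWalk_of_sortedLT [LinearOrder α] (hST : ∀ a b : α, a ⋖ b → T a = S b) {z : α}
    (hz : ∀ a, a ≤ z) :
    ∀ {l : List α} {a : α}, (a :: l).SortedLT → (∀ b, a < b → b ∈ l) →
      IsWalk S T (a :: l) (S a) (T z)
  | [], a, _, hl => by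
    have : a = z := by
      by_contra hne
      exact absurd (hl z (lt_of_le_of_ne (hz a) hne)) (by simp)
    subst this
    exact ⟨rfl, rfl⟩
  | b :: l, a, hs, hl => by
    have hs' := hs.pairwise
    rw [List.pairwise_cons] at hs'
    have hs2 := List.pairwise_cons.1 hs'.2
    have hcov : a ⋖ b := by
      refine ⟨hs'.1 b (by simp), fun c hac hcb => ?_⟩
      rcases List.mem_cons.1 (hl c hac) with rfl | hc
      · exact lt_irrefl _ hcb
      · exact lt_asymm hcb (hs2.1 c hc)
    refine ⟨rfl, ?_⟩
    rw [hST a b hcov]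
    refine isWalk_of_sortedLT hST hz hs'.2.sortedLT fun c hbc => ?_
    rcases List.mem_cons.1 (hl c (hcov.lt.trans hbc)) with rfl | hc
    · exact absurd hbc (lt_irrefl _)
    · exact hc

theorem isWalk_sort [LinearOrder α] [Fintype α] (hST : ∀ a b : α, a ⋖ b → T a = S b) {y z : α}
    (hy : ∀ a, y ≤ a) (hz : ∀ a, a ≤ z) :
    IsWalk S T ((Finset.univ : Finset α).sort (· ≤ ·)) (S y) (T z) := by
  have hs := (Finset.univ : Finset α).sortedLT_sort
  have hmem : ∀ a, a ∈ (Finset.univ : Finset α).sort (· ≤ ·) := fun a => by simp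
  generalize (Finset.univ : Finset α).sort (· ≤ ·) = l at hs hmem
  cases l with
  | nil => exact absurd (hmem y) (by simp)
  | cons a l =>
    have hs' := List.pairwise_cons.1 hs.pairwise
    have : a = y := by
      rcases List.mem_cons.1 (hmem y) with h | h
      · exact h.symm
      · exact le_antisymm (hs'.1 y h).le (hy a)
    subst this
    refine isWalk_of_sortedLT hST hz hs fun b hb => ?_
    rcases List.mem_cons.1 (hmem b) with rfl | h
    · exact absurd hb (lt_irrefl _)
    · exact h

/-- A covering pair is a pair of consecutive entries of the increasing enumeration. -/
theorem CovBy.infix_sort [LinearOrder α] [Fintype α] {p q : α} (h : p ⋖ q) :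
    [p, q] <:+: (Finset.univ : Finset α).sort (· ≤ ·) := by
  have hs := (Finset.univ : Finset α).sortedLT_sort
  have hmem : ∀ a, a ∈ (Finset.univ : Finset α).sort (· ≤ ·) := fun a => by simp
  generalize (Finset.univ : Finset α).sort (· ≤ ·) = l at hs hmem
  obtain ⟨s, t, rfl⟩ := List.append_of_mem (hmem p)
  have hs' := List.pairwise_append.1 hs.pairwise
  have hpt := List.pairwise_cons.1 hs'.2.1
  have hqt : q ∈ t := by
    rcases List.mem_append.1 (hmem q) with hq | hq
    · exact absurd (hs'.2.2 q hq p (by simp)) (lt_asymm h.lt)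
    · rcases List.mem_cons.1 hq with hq | hq
      · exact absurd hq h.lt.ne'
      · exact hq
  cases t with
  | nil => exact absurd hqt (by simp)
  | cons b t =>
    have : b = q := by
      rcases List.mem_cons.1 hqt with hq | hq
      · exact hq.symm
      · exact absurd ((List.pairwise_cons.1 hpt.2).1 q hq) (h.2 (hpt.1 b (by simp)))
    subst this
    exact ⟨s, t, by simp⟩

theorem Sigma.Lex.covBy_of_max_of_min {ι : Type*} {γ : ι → Type*} [LinearOrder ι]
    [∀ i, LinearOrder (γ i)] {i j : ι} (h : i ⋖ j) {a : γ i} {b : γ j} (ha : ∀ c, c ≤ a)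
    (hb : ∀ c, b ≤ c) : (toLex ⟨i, a⟩ : Σₗ i, γ i) ⋖ toLex ⟨j, b⟩ := by
  refine ⟨Sigma.Lex.left _ _ h.lt, fun c h1 h2 => ?_⟩
  obtain ⟨l, c⟩ := c
  rcases Sigma.Lex.lt_def.1 h1 with h1 | ⟨h1, h1'⟩
  · rcases Sigma.Lex.lt_def.1 h2 with h2 | ⟨h2, h2'⟩
    · exact h.2 h1 h2
    · obtain rfl : l = j := h2
      exact absurd h2' (not_lt.2 (hb _))
  · obtain rfl : i = l := h1
    exact absurd h1' (not_lt.2 (ha _))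

end Walk

/-! ### The combinatorial core -/

/-- The word problem behind the class `ℳ`: the letters `Sum.inr u` are the edges, other than loops
at the vertices `some i`, of a multigraph with at least `k` vertices, and every one of them is
spanned by a walk through all edges. -/
theorem isInClassM_of_walks {k : ℕ} {P : Type*} [DecidableEq (P ⊕ Fin k)] {comp : P → Fin k}
    (hcomp : comp.Surjective)
    {S T : P ⊕ Fin k → Option (Fin k)} (hS : ∀ p, S (Sum.inl p) = some (comp p))
    (hT : ∀ p, T (Sum.inl p) = some (comp p)) (w : Fin k → List (P ⊕ Fin k))
    (hmem : ∀ v a, a ∈ w v) (hwalk : ∀ v, IsWalk S T (w v) (S (Sum.inr v)) (T (Sum.inr v)))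
    (hk : 2 ≤ k) (v : Fin k) :
    ∃ f : ℕ, ∀ u, (w v).countP (fun a => a = Sum.inr u) = if v = u then f + 1 else f := by
  classical
  have : Nontrivial (Fin k) := Fin.nontrivial_iff_two_le.2 hk
  set S' : Fin k → Option (Fin k) := fun u => S (Sum.inr u) with hS'
  set T' : Fin k → Option (Fin k) := fun u => T (Sum.inr u) with hT'
  set w' : Fin k → List (Fin k) := fun v => (w v).filterMap Sum.getRight? with hw'
  have hmem' : ∀ v u, u ∈ w' v := fun v u => List.mem_filterMap.2 ⟨_, hmem v (Sum.inr u), rfl⟩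
  have hwalk' : ∀ v, IsWalk S' T' (w' v) (S' v) (T' v) := fun v => by
    refine IsWalk.filterMap _ ?_ ?_ (hwalk v)
    · rintro (p | u) h
      · rw [hS, hT]
      · simp at h
    · rintro (p | u) b h
      · simp at h
      · simp only [Sum.getRight?_inr, Option.some.injEq] at h
        subst h
        exact ⟨rfl, rfl⟩
  have hcount : ∀ v u, (w' v).count u = (w v).countP fun a => a = Sum.inr u := fun v u => by
    rw [hw', List.count_filterMap]
    congr 1
    funext a
    rw [Bool.eq_iff_iff]
    rcases a with p | u' <;> simp
  have hcons : ∀ v, ∃ a b l, w' v = a :: b :: l := fun v => by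
    obtain ⟨u, hu⟩ := exists_ne v
    have h1 := hmem' v v
    have h2 := hmem' v u
    rcases hl : w' v with _ | ⟨a, _ | ⟨b, l⟩⟩
    · simp [hl] at h1
    · simp only [hl, List.mem_singleton] at h1 h2
      exact absurd (h2.trans h1.symm) hu
    · exact ⟨a, b, l, rfl⟩
  -- Otherwise `some i` is a trap. Every walk meets a loop there, so every `T' v` is `some i`; but
  -- the second letter of a word starts where the first one ends, and no remaining edge starts at
  -- `some i`.
  have hSsurj : ∀ i, ∃ u, S' u = some i := fun i => by
    by_contra hno
    push Not at hno
    have htrap : ∀ a, S a = some i → T a = some i := by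
      rintro (p | u) h
      · rw [hT, ← hS, h]
      · exact absurd h (hno u)
    obtain ⟨p, rfl⟩ := hcomp i
    have hend : ∀ v, T' v = some (comp p) := fun v =>
      IsWalk.eq_of_trap_of_mem htrap (hS p) (hwalk v) (hmem v _)
    obtain ⟨a, b, l, hl⟩ := hcons v
    have h := hwalk' v
    rw [hl] at h
    exact hno b (h.2.1.trans (hend a))
  -- There are as many edges as components, so a choice of one edge per component exhausts the
  -- edges; in particular `none` is never a value.
  have inj_of_surj : ∀ F : Fin k → Option (Fin k), (∀ i, ∃ u, F u = some i) → F.Injective := by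
    intro F hF
    choose g hg using hF
    have hginj : g.Injective := fun i j hij => by
      have := hg i
      rw [hij, hg j] at this
      exact (Option.some.inj this).symm
    have hgsurj := Finite.surjective_of_injective hginj
    intro a b hab
    obtain ⟨i, rfl⟩ := hgsurj a
    obtain ⟨j, rfl⟩ := hgsurj b
    rw [hg, hg] at hab
    rw [Option.some.inj hab]
  have hSinj := inj_of_surj S' hSsurj
  have hhead : ∀ v, ∃ l, w' v = v :: l ∧ IsWalk S' T' l (T' v) (T' v) := fun v => by
    obtain ⟨a, b, l, hl⟩ := hcons v
    have h := hwalk' v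
    rw [hl] at h
    obtain rfl := hSinj h.1
    exact ⟨_, hl, h.2⟩
  -- The edge `u` leaving `some i` occurs in the word of any `v ≠ u` after the first letter, so some
  -- edge precedes it and ends at `some i`.
  have hTsurj : ∀ i, ∃ u, T' u = some i := fun i => by
    obtain ⟨u, hu⟩ := hSsurj i
    obtain ⟨v, hv⟩ := exists_ne u
    obtain ⟨l, hl, h⟩ := hhead v
    have hul : u ∈ l := by
      have := hmem' v u
      rw [hl] at this
      exact (List.mem_cons.1 this).resolve_left hv.symm
    obtain ⟨c, hc⟩ := h.exists_pred hul
    exact ⟨c, hc.trans hu⟩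
  have hTinj := inj_of_surj T' hTsurj
  obtain ⟨l, hl, h⟩ := hhead v
  refine ⟨l.count v, fun u => ?_⟩
  have hconst : l.count u = l.count v := by
    rcases eq_or_ne u v with rfl | huv
    · rfl
    · refine h.const_of_step (c := fun u => l.count u)
        (fun a b hab => IsWalk.count_eq_of_closed hSinj hTinj h hab) ?_
      have := hmem' v u
      rw [hl] at this
      exact (List.mem_cons.1 this).resolve_left huv
  rw [← hcount v u, hl, List.count_cons, hconst]
  by_cases hvu : v = u <;> simp [hvu]

/-! ### Extreme edges and words of sources -/

namespace BratteliDiagram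

variable {B : BratteliDiagram.{u}}

theorem nonempty_edgesInto {n : ℕ} (v : B.V (n + 1)) : Nonempty (B.EdgesInto v) := by
  obtain ⟨e, he⟩ := B.r_surjective n v
  exact ⟨⟨e, he⟩⟩

theorem finite_edgesInto {n : ℕ} (v : B.V (n + 1)) : Finite (B.EdgesInto v) := by
  have := B.finite_E n
  infer_instance

namespace Ordering

variable (ω : B.Ordering)

theorem exists_max {n : ℕ} (v : B.V (n + 1)) : ∃ e : B.EdgesInto v, ∀ f, (ω n v).le f e := by
  let := ω n v
  have := nonempty_edgesInto v
  have := finite_edgesInto v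
  exact Finite.exists_max (id : B.EdgesInto v → B.EdgesInto v)

theorem exists_min {n : ℕ} (v : B.V (n + 1)) : ∃ e : B.EdgesInto v, ∀ f, (ω n v).le e f := by
  let := ω n v
  have := nonempty_edgesInto v
  have := finite_edgesInto v
  exact Finite.exists_min (id : B.EdgesInto v → B.EdgesInto v)

variable {ω}

theorem isMaxEdge_iff {n : ℕ} {v : B.V (n + 1)} (e : B.EdgesInto v) :
    ω.IsMaxEdge e.1 ↔ ∀ f, (ω n v).le f e := by
  obtain ⟨e, rfl⟩ := e
  rfl

theorem isMinEdge_iff {n : ℕ} {v : B.V (n + 1)} (e : B.EdgesInto v) :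
    ω.IsMinEdge e.1 ↔ ∀ f, (ω n v).le e f := by
  obtain ⟨e, rfl⟩ := e
  rfl

/-- The last path of length two through the edge `e` and the first one through the successor of
`e` are consecutive, so their sources form a two-letter subword. -/
theorem infix_word_of_covBy {m : ℕ} {v : B.V (m + 2)} {e f : B.EdgesInto v}
    (hef : letI := ω (m + 1) v; e ⋖ f) (a : B.EdgesInto (B.s e.1)) (b : B.EdgesInto (B.s f.1))
    (ha : ω.IsMaxEdge a.1) (hb : ω.IsMinEdge b.1) :
    [B.s a.1, B.s b.1] <:+: ω.word m 2 v := by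
  let := ω (m + 1) v
  let (e : B.EdgesInto v) : LinearOrder (B.PathTo m 1 (B.s e.1)) := ω.pathOrder m 1 (B.s e.1)
  let := ω m (B.s e.1)
  let := ω m (B.s f.1)
  let : LinearOrder (B.PathTo m 2 v) := ω.pathOrder m 2 v
  let : Fintype (B.PathTo m 2 v) := @Fintype.ofFinite _ (PathTo.finite m 2 v)
  let (u : B.V m) : LinearOrder (B.PathTo m 0 u) := ω.pathOrder m 0 u
  let p : B.PathTo m 1 (B.s e.1) := toLex ⟨a, PUnit.unit⟩
  let q : B.PathTo m 1 (B.s f.1) := toLex ⟨b, PUnit.unit⟩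
  have hp : ∀ c, c ≤ p := by
    intro c
    obtain ⟨c, d⟩ := c
    refine Sigma.Lex.le_def.2 ?_
    rcases lt_or_eq_of_le ((isMaxEdge_iff a).1 ha c) with h | rfl
    · exact Or.inl h
    · exact Or.inr ⟨rfl, le_rfl⟩
  have hq : ∀ c, q ≤ c := by
    intro c
    obtain ⟨c, d⟩ := c
    refine Sigma.Lex.le_def.2 ?_
    rcases lt_or_eq_of_le ((isMinEdge_iff b).1 hb c) with h | rfl
    · exact Or.inl h
    · exact Or.inr ⟨rfl, le_rfl⟩
  have hcov : (toLex ⟨e, p⟩ : B.PathTo m 2 v) ⋖ (toLex ⟨f, q⟩ : B.PathTo m 2 v) :=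
    Sigma.Lex.covBy_of_max_of_min hef hp hq
  exact (CovBy.infix_sort (α := B.PathTo m 2 v) hcov).map PathTo.source

variable {W : Type} (lab : B.Labelling W) (ω)

/-- The word formed by the labels of the sources of the edges with range `v`. -/
noncomputable def edgeWord (n : ℕ) (v : B.V (n + 2)) : List W :=
  letI := ω (n + 1) v
  letI : Fintype (B.EdgesInto v) := @Fintype.ofFinite _ (finite_edgesInto v)
  ((Finset.univ : Finset (B.EdgesInto v)).sort (· ≤ ·)).map fun e => lab n (B.s e.1)

theorem length_edgeWord (n : ℕ) (v : B.V (n + 2)) :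
    (ω.edgeWord lab n v).length = Nat.card (B.EdgesInto v) := by
  let : Fintype (B.EdgesInto v) := @Fintype.ofFinite _ (finite_edgesInto v)
  rw [edgeWord, List.length_map, Finset.length_sort, Finset.card_univ, Nat.card_eq_fintype_card]

theorem countP_edgeWord [DecidableEq W] (n : ℕ) (v : B.V (n + 2)) (a : W) :
    (ω.edgeWord lab n v).countP (fun b => b = a) = B.incidence (n + 1) v ((lab n).symm a) := by
  classical
  let := ω (n + 1) v
  let : Fintype (B.EdgesInto v) := @Fintype.ofFinite _ (finite_edgesInto v)
  have h1 : (ω.edgeWord lab n v).countP (fun b => b = a) =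
      Nat.card {e : B.EdgesInto v // lab n (B.s e.1) = a} := by
    rw [edgeWord, List.countP_map, List.countP_eq_length_filter,
      ← List.toFinset_card_of_nodup ((Finset.sort_nodup _ _).filter _), List.toFinset_filter,
      Finset.sort_toFinset, Nat.card_eq_fintype_card, Fintype.card_subtype]
    congr 1
    ext e
    simp
  rw [h1, incidence]
  refine Nat.card_congr ((Equiv.subtypeSubtypeEquivSubtypeInter (fun e => B.r e = v)
    fun e => lab n (B.s e) = a).trans ?_)
  exact Equiv.subtypeEquivRight fun e => by rw [Equiv.eq_symm_apply]

variable {lab ω}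

theorem mem_minVertices_range {a : W} (ha : a ∈ ω.minVertices lab) (n : ℕ) :
    ∃ e : B.E (n + 1), ω.IsMinEdge e ∧ lab (n + 1) (B.r e) = a ∧ lab n (B.s e) = a := by
  obtain ⟨x, hx, hv⟩ := ha
  exact ⟨x.1 (n + 1), hx (n + 1), hv (n + 1), by rw [← x.2 n, hv n]⟩

theorem mem_maxVertices_range {a : W} (ha : a ∈ ω.maxVertices lab) (n : ℕ) :
    ∃ e : B.E (n + 1), ω.IsMaxEdge e ∧ lab (n + 1) (B.r e) = a ∧ lab n (B.s e) = a := by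
  obtain ⟨x, hx, hv⟩ := ha
  exact ⟨x.1 (n + 1), hx (n + 1), hv (n + 1), by rw [← x.2 n, hv n]⟩

namespace IsWellTelescoped

/-- Condition 3 makes the source of the minimal edge a function of the label alone; vertical minimal
paths show that it fixes the minimal vertices. -/
theorem exists_sourceMin (h : ω.IsWellTelescoped lab) :
    ∃ N : W → ω.minVertices lab, (∀ a : ω.minVertices lab, N a = a) ∧
      ∀ (n : ℕ) (e : B.E (n + 1)), ω.IsMinEdge e →
        (N (lab (n + 1) (B.r e)) : W) = lab n (B.s e) := by
  have key : ∀ w : W, ∃ a : ω.minVertices lab, ∀ (n : ℕ) (e : B.E (n + 1)), ω.IsMinEdge e →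
      lab (n + 1) (B.r e) = w → (a : W) = lab n (B.s e) := fun w => by
    obtain ⟨e, he⟩ := ω.exists_min ((lab 1).symm w)
    have hmin := (isMinEdge_iff e).2 he
    refine ⟨⟨_, h.source_min_mem 0 e.1 hmin⟩, fun n e' he' hw => ?_⟩
    exact h.source_min_indep 0 n e.1 e' hmin he' (by simp [hw, e.2])
  choose N hN using key
  refine ⟨N, fun a => ?_, fun n e he => hN _ n e he rfl⟩
  obtain ⟨e, he, hr, hs⟩ := mem_minVertices_range a.2 0
  exact Subtype.ext ((hN a 0 e he hr).trans hs)

theorem exists_sourceMax (h : ω.IsWellTelescoped lab) :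
    ∃ M : W → ω.maxVertices lab, (∀ a : ω.maxVertices lab, M a = a) ∧
      ∀ (n : ℕ) (e : B.E (n + 1)), ω.IsMaxEdge e →
        (M (lab (n + 1) (B.r e)) : W) = lab n (B.s e) := by
  have key : ∀ w : W, ∃ a : ω.maxVertices lab, ∀ (n : ℕ) (e : B.E (n + 1)), ω.IsMaxEdge e →
      lab (n + 1) (B.r e) = w → (a : W) = lab n (B.s e) := fun w => by
    obtain ⟨e, he⟩ := ω.exists_max ((lab 1).symm w)
    have hmax := (isMaxEdge_iff e).2 he
    refine ⟨⟨_, h.source_max_mem 0 e.1 hmax⟩, fun n e' he' hw => ?_⟩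
    exact h.source_max_indep 0 n e.1 e' hmax he' (by simp [hw, e.2])
  choose M hM using key
  refine ⟨M, fun a => ?_, fun n e he => hM _ n e he rfl⟩
  obtain ⟨e, he, hr, hs⟩ := mem_maxVertices_range a.2 0
  exact Subtype.ext ((hM a 0 e he hr).trans hs)

/-- Every letter `a` of a well telescoped perfectly ordered diagram is an edge, from `S a` to
`T a`, of a graph whose vertices are the minimal vertices, and the words of the sources of the
edges into a vertex are walks in this graph. -/
theorem exists_isWalk_edgeWord (h : ω.IsWellTelescoped lab) (hω : ω.IsPerfect) :
    ∃ S T : W → ω.minVertices lab,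
      (∀ (n : ℕ) (e : B.E (n + 1)), ω.IsMinEdge e →
        (S (lab (n + 1) (B.r e)) : W) = lab n (B.s e)) ∧
      ∀ (n : ℕ) (v : B.V (n + 3)), IsWalk S T (ω.edgeWord lab (n + 1) v)
        (S (lab (n + 2) v)) (T (lab (n + 2) v)) := by
  obtain ⟨σ, hσ⟩ := h.exists_bijection hω
  obtain ⟨N, hNN, hN⟩ := h.exists_sourceMin
  obtain ⟨M, hMM, hM⟩ := h.exists_sourceMax
  refine ⟨N, fun a => σ (M a), hN, fun n v => ?_⟩
  dsimp only
  let := ω (n + 2) v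
  let : Fintype (B.EdgesInto v) := @Fintype.ofFinite _ (finite_edgesInto v)
  refine IsWalk.map _ ?_
  obtain ⟨y, hy⟩ := ω.exists_min v
  obtain ⟨z, hz⟩ := ω.exists_max v
  -- `N v` is the first letter of the word and is itself a minimal vertex, hence fixed by `N`: the
  -- walk starts at `S v`. The end is handled likewise.
  have hy' : N (lab (n + 2) v) = N (lab (n + 1) (B.s y.1)) := by
    have := hN (n + 1) y.1 ((isMinEdge_iff y).2 hy)
    rw [y.2] at this
    rw [← this, hNN]
  have hz' : M (lab (n + 2) v) = M (lab (n + 1) (B.s z.1)) := by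
    have := hM (n + 1) z.1 ((isMaxEdge_iff z).2 hz)
    rw [z.2] at this
    rw [← this, hMM]
  rw [hy', show σ (M (lab (n + 2) v)) = σ (M (lab (n + 1) (B.s z.1))) from congrArg _ hz']
  refine isWalk_sort (S := N ∘ fun e : B.EdgesInto v => lab (n + 1) (B.s e.1))
    (T := (fun a => σ (M a)) ∘ fun e : B.EdgesInto v => lab (n + 1) (B.s e.1)) ?_ hy hz
  intro e f hef
  obtain ⟨a, ha⟩ := ω.exists_max (B.s e.1)
  obtain ⟨b, hb⟩ := ω.exists_min (B.s f.1)
  have hinf := infix_word_of_covBy (m := n + 1) hef a b ((isMaxEdge_iff a).2 ha)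
    ((isMinEdge_iff b).2 hb)
  -- The paths of length two start at level `n + 1 ≥ 1`, as condition 4 requires. This costs one
  -- level and is why the result starts at `C 2`.
  refine hσ n 1 v _ _ ?_
  have hMa := hM n a.1 ((isMaxEdge_iff a).2 ha)
  have hNb := hN n b.1 ((isMinEdge_iff b).2 hb)
  rw [a.2] at hMa
  rw [b.2] at hNb
  have := hinf.map (lab n)
  simp only [List.map_cons, List.map_nil] at this
  rw [← hMa, ← hNb] at this
  exact this

end IsWellTelescoped

end Ordering

/-! ### Minimal components of diagrams of class `𝒜` -/

namespace ClassA

variable {k d : ℕ} (hA : B.ClassA k d)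

/-- The index of the minimal component which contains a vertex, if there is one. -/
def component : (Σ i, Fin (hA.dims i)) ⊕ Fin d → Option (Fin k) :=
  Sum.elim (fun p => some p.1) fun _ => none

variable (ω : B.Ordering)

theorem countP_edgeWord (n : ℕ) (a b : (Σ i, Fin (hA.dims i)) ⊕ Fin d) :
    (ω.edgeWord hA.lab n ((hA.lab (n + 1)).symm a)).countP (fun c => c = b) =
      blockForm (hA.A (n + 1)) (hA.L (n + 1)) (hA.C (n + 1)) a b := by
  rw [Ordering.countP_edgeWord, ← hA.incidence_eq]
  rfl

theorem mem_edgeWord_inr (n : ℕ) (j : Fin d) (b : (Σ i, Fin (hA.dims i)) ⊕ Fin d) :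
    b ∈ ω.edgeWord hA.lab n ((hA.lab (n + 1)).symm (Sum.inr j)) := by
  rw [← List.countP_eq_pos_iff, hA.countP_edgeWord]
  rcases b with b | b
  · exact hA.L_pos _ (by omega) _ _ _
  · exact hA.C_pos _ (by omega) _ _

theorem mem_edgeWord_inl (n : ℕ) {p q : Σ i, Fin (hA.dims i)} (h : p.1 = q.1) :
    Sum.inl p ∈ ω.edgeWord hA.lab n ((hA.lab (n + 1)).symm (Sum.inl q)) := by
  obtain ⟨i, x⟩ := p
  obtain ⟨j, y⟩ := q
  obtain rfl : i = j := h
  rw [← List.countP_eq_pos_iff, hA.countP_edgeWord]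
  simpa [blockForm, Matrix.blockDiagonal'_apply] using hA.A_pos (n + 1) (by omega) i y x

/-- The zero blocks of the incidence matrix forbid edges into a minimal component from outside. -/
theorem component_source_of_inl {n : ℕ} {e : B.E (n + 1)} {p : Σ i, Fin (hA.dims i)}
    (he : hA.lab (n + 1) (B.r e) = Sum.inl p) :
    hA.component (hA.lab n (B.s e)) = some p.1 := by
  have h1 : 0 < blockForm (hA.A (n + 1)) (hA.L (n + 1)) (hA.C (n + 1)) (Sum.inl p)
      (hA.lab n (B.s e)) := by
    rw [← hA.incidence_eq, ← he, Matrix.reindex_apply, Matrix.submatrix_apply,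
      Equiv.symm_apply_apply, Equiv.symm_apply_apply, incidence]
    have := B.finite_E (n + 1)
    have : Nonempty {f : B.E (n + 1) // B.r f = B.r e ∧ B.s f = B.s e} := ⟨⟨e, rfl, rfl⟩⟩
    exact Nat.card_pos
  generalize hA.lab n (B.s e) = a at h1
  rcases a with q | j
  · by_contra hne
    have hne' : p.1 ≠ q.1 := fun h => hne (by simp [component, h])
    simp [blockForm, Matrix.blockDiagonal'_apply, hne'] at h1
  · simp [blockForm] at h1

end ClassA

end BratteliDiagram

namespace BratteliDiagram

variable {B : BratteliDiagram.{u}}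

namespace ClassA

variable {k d : ℕ} (hA : B.ClassA k d) {ω : B.Ordering}

theorem exists_of_component_eq {a : (Σ i, Fin (hA.dims i)) ⊕ Fin d} {i : Fin k}
    (h : hA.component a = some i) : ∃ p : Σ i, Fin (hA.dims i), a = Sum.inl p ∧ p.1 = i := by
  rcases a with p | j
  · exact ⟨p, rfl, by simpa [component] using h⟩
  · simp [component] at h

theorem component_of_mem_edgeWord {n : ℕ} {p : Σ i, Fin (hA.dims i)}
    {a : (Σ i, Fin (hA.dims i)) ⊕ Fin d}
    (ha : a ∈ ω.edgeWord hA.lab n ((hA.lab (n + 1)).symm (Sum.inl p))) :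
    hA.component a = some p.1 := by
  obtain ⟨e, -, rfl⟩ := List.mem_map.1 ha
  exact hA.component_source_of_inl (by rw [e.2, Equiv.apply_symm_apply])

theorem component_tail {S : (Σ i, Fin (hA.dims i)) ⊕ Fin d → ω.minVertices hA.lab}
    (hS : ∀ (n : ℕ) (e : B.E (n + 1)), ω.IsMinEdge e →
      (S (hA.lab (n + 1) (B.r e)) : (Σ i, Fin (hA.dims i)) ⊕ Fin d) = hA.lab n (B.s e))
    {a : (Σ i, Fin (hA.dims i)) ⊕ Fin d} {i : Fin k} (ha : hA.component a = some i) :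
    hA.component (S a) = some i := by
  obtain ⟨p, rfl, rfl⟩ := hA.exists_of_component_eq ha
  obtain ⟨e, he⟩ := ω.exists_min ((hA.lab 1).symm (Sum.inl p))
  have h1 : hA.lab 1 (B.r e.1) = Sum.inl p := by rw [e.2, Equiv.apply_symm_apply]
  have h2 := hS 0 e.1 ((Ordering.isMinEdge_iff e).2 he)
  rw [h1] at h2
  rw [h2]
  exact hA.component_source_of_inl h1

/-- A priori `σ` could move between components. Words of a component have at least two letters, all
in that component, so their first letter `u` ends where the second starts, inside it. As the
diagonal block is positive, `p` occurs in the word of `u`: either it is followed there by a letter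
of the component, or it is last and ends where `u` does. -/
theorem component_head (hwell : ω.IsWellTelescoped hA.lab)
    {S T : (Σ i, Fin (hA.dims i)) ⊕ Fin d → ω.minVertices hA.lab}
    (hS : ∀ (n : ℕ) (e : B.E (n + 1)), ω.IsMinEdge e →
      (S (hA.lab (n + 1) (B.r e)) : (Σ i, Fin (hA.dims i)) ⊕ Fin d) = hA.lab n (B.s e))
    (hwalk : ∀ (n : ℕ) (v : B.V (n + 3)), IsWalk S T (ω.edgeWord hA.lab (n + 1) v)
        (S (hA.lab (n + 2) v)) (T (hA.lab (n + 2) v))) (p : Σ i, Fin (hA.dims i)) :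
    hA.component (T (Sum.inl p)) = some p.1 := by
  have hlen := ω.length_edgeWord hA.lab 1 ((hA.lab 2).symm (Sum.inl p)) ▸
    hwell.two_le_card 2 ((hA.lab 2).symm (Sum.inl p))
  have hw : IsWalk S T (ω.edgeWord hA.lab 1 ((hA.lab 2).symm (Sum.inl p))) _ _ :=
    hwalk 0 ((hA.lab 2).symm (Sum.inl p))
  have hcomp : ∀ a ∈ ω.edgeWord hA.lab 1 ((hA.lab 2).symm (Sum.inl p)),
    hA.component a = some p.1 := fun a ha => hA.component_of_mem_edgeWord ha
  generalize ω.edgeWord hA.lab 1 ((hA.lab 2).symm (Sum.inl p)) = w at hlen hw hcomp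
  rcases w with _ | ⟨u, _ | ⟨c, t⟩⟩
  · simp at hlen
  · simp at hlen
  have hu := hw.2.1
  obtain ⟨q, rfl, hq⟩ := hA.exists_of_component_eq (hcomp u (by simp))
  have hmem : Sum.inl p ∈ ω.edgeWord hA.lab 1 ((hA.lab 2).symm (Sum.inl q)) :=
    hA.mem_edgeWord_inl ω 1 hq.symm
  rcases (hwalk 0 ((hA.lab 2).symm (Sum.inl q))).eq_or_exists_succ hmem with h | ⟨b, hb, h⟩
  · rw [h, Equiv.apply_symm_apply, ← hu]
    exact hA.component_tail hS (hcomp c (by simp))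
  · rw [h, ← hq]
    exact hA.component_tail hS (hA.component_of_mem_edgeWord hb)

end ClassA

end BratteliDiagram

/-! ### Assembly -/

theorem mainTheorem9 {k : ℕ} (B : BratteliDiagram.{u}) (hA : B.ClassA k k) (ω : B.Ordering)
    (hperfect : ω.IsPerfect) (hwell : ω.IsWellTelescoped hA.lab) :
    ∀ n : ℕ, 2 ≤ n → IsInClassM (hA.C n) := by
  intro n hn
  obtain ⟨m, rfl⟩ := Nat.exists_eq_add_of_le' hn
  -- For `k ≤ 1` there are no two distinct letters to compare, and positivity of the entry suffices.
  rcases lt_or_ge k 2 with hk | hk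
  · have : Subsingleton (Fin k) := Fin.subsingleton_iff_le_one.2 (by omega)
    refine ⟨fun i => hA.C (m + 2) i i - 1, fun i j => ?_⟩
    obtain rfl := Subsingleton.elim i j
    have := hA.C_pos (m + 2) (by omega) i i
    simp only [if_true]
    omega
  · obtain ⟨S, T, hS, hwalk⟩ := hwell.exists_isWalk_edgeWord hperfect
    let w : Fin k → List ((Σ i, Fin (hA.dims i)) ⊕ Fin k) := fun j =>
      ω.edgeWord hA.lab (m + 1) ((hA.lab (m + 2)).symm (Sum.inr j))
    have key := isInClassM_of_walks (comp := fun p : Σ i, Fin (hA.dims i) => p.1)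
      (fun i => ⟨⟨i, ⟨0, hA.dims_pos i⟩⟩, rfl⟩)
      (S := fun a => hA.component (S a)) (T := fun a => hA.component (T a))
      (fun p => hA.component_tail hS rfl)
      (fun p => hA.component_head hwell hS hwalk p) w
      (fun j a => hA.mem_edgeWord_inr ω (m + 1) j a)
      (fun j => by
        have := (hwalk m ((hA.lab (m + 2)).symm (Sum.inr j))).image fun a => hA.component a.1
        rw [Equiv.apply_symm_apply] at this
        exact this) hk
    choose f hf using key
    refine ⟨f, fun i j => ?_⟩
    rw [← hf i j, hA.countP_edgeWord]
    rfl
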